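/- Let $n,s,k\ge 1$ be integers with $sk<n$, let $m>0$, $\mu>0$ and $\varepsilon\in(0,1)$. For $S\subseteq\{1,\dots,n\}$ let $x\in\mathbb{R}^n$ be the signal with $x_i=\mu$ for $i\in S$ and $x_i=0$ for $i\notin S$. An adaptive sensing procedure collects observations $$Y_j=x_{A_j}+\Gamma_j^{-1/2}W_j,\qquad j=1,2,\dots,$$ where $W_j\sim\mathcal N(0,1)$ are i.i.d., the coordinate $A_j\in\{1,\dots,n\}$ and the precision $\Gamma_j\ge 0$ are chosen (possibly at random, by a rule that does not depend on $S$) on the basis of $\{Y_i,A_i,\Gamma_i\}_{i<j}$, and $W_j$ is independent of $\{A_i,\Gamma_i\}_{i\le j}$ and of $\{Y_i\}_{i<j}$; $\Gamma_j=0$ means that no measurement is made at step $j$. The procedure returns an estimator $\hat S\subseteq\{1,\dots,n\}$ that is a measurable function of $\{Y_i,A_i,\Gamma_i\}_{i\ge1}$. Let $\mathbb{E}_S$ be the expectation when the support is $S$. An $s$-interval is a set of $s$ consecutive elements of $\{1,\dots,n\}$. Let $\mathcal C$ be the class of all unions of $k$ pairwise disjoint $s$-intervals and all unions of $k-1$ pairwise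 disjoint $s$-intervals (the empty set if $k=1$). Suppose that the procedure satisfies the precision budget $\mathbb{E}_S\big(\sum_j\Gamma_j\big)\le m$ for every $S\in\mathcal C$, and that $$\max_{S\in\mathcal C}\ \mathbb{E}_S\big(|\hat S\triangle S|\big)\le\varepsilon .$$ Then necessarily $$\mu\ \ge\ \sqrt{\frac{2(n-sk)}{sm}\left(\log k+\log\frac{n-sk}{n+s}+\log\frac{s}{8\varepsilon}\right)},$$ where the right-hand side is read as $0$ when the expression under the square root is negative. -/

import Mathlib

open MeasureTheory ProbabilityTheory
open scoped NNReal ENNReal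

/-- `I` is an `s`-interval: a set of `s` consecutive elements of the index set of size `n`
(the coordinates are numbered `0, …, n - 1`). -/
def IsSInterval (n s : ℕ) (I : Finset (Fin n)) : Prop :=
  ∃ i : ℕ, i + s ≤ n ∧ ∀ a : Fin n, a ∈ I ↔ i ≤ (a : ℕ) ∧ (a : ℕ) < i + s

/-- `S` is the union of `r` pairwise disjoint `s`-intervals. -/
def IsDisjointUnionOfSIntervals (n s r : ℕ) (S : Finset (Fin n)) : Prop :=
  ∃ I : Fin r → Finset (Fin n),
    (∀ l, IsSInterval n s (I l)) ∧
    (∀ l l', l ≠ l' → Disjoint (I l) (I l')) ∧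
    S = Finset.univ.biUnion I

/-- The class of all disjoint unions of `k` or `k - 1` `s`-intervals (used for `1 ≤ k`). -/
def unionIntervalClass (n s k : ℕ) : Set (Finset (Fin n)) :=
  {S | IsDisjointUnionOfSIntervals n s k S ∨ IsDisjointUnionOfSIntervals n s (k - 1) S}

/-- The signal with amplitude `μ` and support `S`. -/
def signal {n : ℕ} (μ : ℝ) (S : Finset (Fin n)) (i : Fin n) : ℝ :=
  if i ∈ S then μ else 0

/-- A sensing action `(A, Γ)`: the coordinate to be measured and the precision of the measurement.
Precision `0` means that no measurement is made, so that stopping is allowed. -/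
abbrev SensingAction (n : ℕ) : Type := Fin n × ℝ≥0

/-- A record `((A, Γ), Y)` of one step: the action and the resulting observation. -/
abbrev SensingRecord (n : ℕ) : Type := SensingAction n × ℝ

/-- The law of the observation `Y = x_A + Γ^{-1/2} W`, `W` standard normal, given the action
`(A, Γ)`: it is the normal law with mean `x_A` and variance `Γ⁻¹`. If `Γ = 0`, nothing is
observed, and the uninformative value `0` is recorded. -/
noncomputable def observationLaw {n : ℕ} (μ : ℝ) (S : Finset (Fin n)) (a : SensingAction n) :
    Measure ℝ :=
  if a.2 = 0 then Measure.dirac 0 else gaussianReal (signal μ S a.1) a.2⁻¹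

theorem measurable_observationLaw {n : ℕ} (μ : ℝ) (S : Finset (Fin n)) :
    Measurable (observationLaw μ S) := by
  have hs : MeasurableSet {a : SensingAction n | a.2 = 0} :=
    measurable_snd (measurableSet_singleton (0 : ℝ≥0))
  have hsig : Measurable (signal μ S) := measurable_of_countable _
  have hpair : Measurable fun a : SensingAction n => (signal μ S a.1, a.2⁻¹) :=
    (hsig.comp measurable_fst).prodMk measurable_snd.inv
  exact Measurable.ite hs measurable_const (measurable_gaussianReal.comp hpair)

/-- The law of the observation as a Markov kernel from actions to observations. -/
noncomputable def observationKernel {n : ℕ} (μ : ℝ) (S : Finset (Fin n)) :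
    Kernel (SensingAction n) ℝ where
  toFun := observationLaw μ S
  measurable' := measurable_observationLaw μ S

instance observationKernel_isMarkovKernel {n : ℕ} (μ : ℝ) (S : Finset (Fin n)) :
    IsMarkovKernel (observationKernel μ S) where
  isProbabilityMeasure a := by
    change IsProbabilityMeasure (observationLaw μ S a)
    unfold observationLaw
    split_ifs <;> infer_instance

/-- An adaptive sensing procedure on `n` coordinates: the law of the first action; for every `j`,
the (possibly degenerate, i.e. deterministic) conditional law of the next action given all the
records of steps `0, …, j`; and an estimator of the support, which is a measurable function of
the whole sequence of records. None of them may depend on the unknown support. -/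
structure AdaptiveProcedure (n : ℕ) where
  /-- law of the first action -/
  first : Measure (SensingAction n)
  /-- conditional law of the action of step `j + 1` given the records of steps `0, …, j` -/
  next : (j : ℕ) → Kernel ((i : Finset.Iic j) → SensingRecord n) (SensingAction n)
  /-- estimator of the support -/
  estimator : (ℕ → SensingRecord n) → Finset (Fin n)
  first_isProbabilityMeasure : IsProbabilityMeasure first
  next_isMarkovKernel : ∀ j, IsMarkovKernel (next j)
  measurable_estimator : Measurable estimator

namespace AdaptiveProcedure

instance {n : ℕ} (p : AdaptiveProcedure n) : IsProbabilityMeasure p.first :=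
  p.first_isProbabilityMeasure

instance {n : ℕ} (p : AdaptiveProcedure n) (j : ℕ) : IsMarkovKernel (p.next j) :=
  p.next_isMarkovKernel j

/-- Law of the record of the first step, for the signal with amplitude `μ` and support `S`. -/
noncomputable def firstRecord {n : ℕ} (p : AdaptiveProcedure n) (μ : ℝ) (S : Finset (Fin n)) :
    Measure (SensingRecord n) :=
  p.first ⊗ₘ observationKernel μ S

instance {n : ℕ} (p : AdaptiveProcedure n) (μ : ℝ) (S : Finset (Fin n)) :
    IsProbabilityMeasure (p.firstRecord μ S) := by
  unfold firstRecord; infer_instance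

/-- Conditional law of the record of step `j + 1` given the earlier records: draw the action, then
the observation, which depends on the past only through the action. -/
noncomputable def nextRecord {n : ℕ} (p : AdaptiveProcedure n) (μ : ℝ) (S : Finset (Fin n))
    (j : ℕ) : Kernel ((i : Finset.Iic j) → SensingRecord n) (SensingRecord n) :=
  p.next j ⊗ₖ (observationKernel μ S).prodMkLeft _

instance {n : ℕ} (p : AdaptiveProcedure n) (μ : ℝ) (S : Finset (Fin n)) (j : ℕ) :
    IsMarkovKernel (p.nextRecord μ S j) := by
  unfold nextRecord; infer_instance

/-- The joint law `P_S` of the whole sequence of records `((A_j, Γ_j), Y_j)`, for the signal with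
amplitude `μ` and support `S`. -/
noncomputable def law {n : ℕ} (p : AdaptiveProcedure n) (μ : ℝ) (S : Finset (Fin n)) :
    Measure (ℕ → SensingRecord n) :=
  Kernel.trajMeasure (X := fun _ : ℕ => SensingRecord n) (p.firstRecord μ S) (p.nextRecord μ S)

instance {n : ℕ} (p : AdaptiveProcedure n) (μ : ℝ) (S : Finset (Fin n)) :
    IsProbabilityMeasure (p.law μ S) := by
  unfold law; infer_instance

/-- The expected total precision `E_S (∑ j, Γ_j)`, in `[0, ∞]`. -/
noncomputable def expectedPrecision {n : ℕ} (p : AdaptiveProcedure n) (μ : ℝ)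
    (S : Finset (Fin n)) : ℝ≥0∞ :=
  ∫⁻ ω, ∑' j : ℕ, ((ω j).1.2 : ℝ≥0∞) ∂(p.law μ S)

/-- The expected Hamming distance `E_S |Ŝ ∆ S|`, in `[0, ∞]`. -/
noncomputable def expectedHamming {n : ℕ} (p : AdaptiveProcedure n) (μ : ℝ)
    (S : Finset (Fin n)) : ℝ≥0∞ :=
  ∫⁻ ω, ((symmDiff (p.estimator ω) S).card : ℝ≥0∞) ∂(p.law μ S)

end AdaptiveProcedure

/-! Cut the coordinates into `n / s` consecutive blocks of length `s` and use only supports that are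
unions of `k - 1` or `k` blocks. For a set `B` of `k - 1` blocks and a block `b` outside it, each
coordinate of `b` gives a test between `B` and `insert b B`. Under the smaller support the expected
log-likelihood ratio is `-μ ^ 2 / 2` times the expected precision `D` spent on `b`, since the action
rules do not depend on the support and cancel. Integrating a tangent inequality for `min 1 (exp x)`
bounds the two error probabilities below by `c * (-log c - μ ^ 2 / 2 * D)` for every `c > 0`
(`le_measureReal_add_measureReal_compl`).

This bound is affine in `D` with a common `c`, so it can be averaged over all pairs `(B, b)`
(`le_of_pairwise_le_insert`). With `N = n / s + 1 - k` blocks outside `B`, the budget makes the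
average of `D` at most `m / N`. The Hamming risk caps the summed errors at `ε` per support, and
counting pairs yields `ε * (1 / N + 1 / k)`. The best `c` for precision `m / N` gives
`block_error_bound`; taking logarithms and estimating `N` concludes. -/

/-! ### Likelihood ratio of a single record. -/

theorem gaussianReal_eq_withDensity (x y : ℝ) {v : ℝ≥0} (hv : v ≠ 0) :
    gaussianReal y v = (gaussianReal x v).withDensity fun z =>
      ENNReal.ofReal (Real.exp ((v : ℝ)⁻¹ * (y - x) * (z - x) - (v : ℝ)⁻¹ * (y - x) ^ 2 / 2)) := by
  have hv' : (v : ℝ) ≠ 0 := by exact_mod_cast hv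
  rw [gaussianReal_of_var_ne_zero _ hv, gaussianReal_of_var_ne_zero _ hv,
    ← withDensity_mul _ (measurable_gaussianPDF _ _) (by fun_prop)]
  congr 1
  ext z
  simp only [Pi.mul_apply, gaussianPDF, gaussianPDFReal]
  rw [← ENNReal.ofReal_mul (by positivity), mul_assoc _ (Real.exp _) (Real.exp _),
    ← Real.exp_add]
  congr 3
  field_simp
  ring

/-- The log-likelihood ratio of the supports `S'` and `S` for a single record. -/
noncomputable def logRatio {n : ℕ} (μ : ℝ) (S S' : Finset (Fin n)) (r : SensingRecord n) : ℝ :=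
  r.1.2 * (signal μ S' r.1.1 - signal μ S r.1.1) * (r.2 - signal μ S r.1.1) -
    r.1.2 * (signal μ S' r.1.1 - signal μ S r.1.1) ^ 2 / 2

@[fun_prop]
theorem measurable_logRatio {n : ℕ} (μ : ℝ) (S S' : Finset (Fin n)) :
    Measurable (logRatio μ S S') := by
  have h : ∀ S : Finset (Fin n), Measurable fun r : SensingRecord n => signal μ S r.1.1 :=
    fun S => (measurable_of_countable (signal μ S)).comp (measurable_fst.comp measurable_fst)
  have := h S
  have := h S'
  unfold logRatio
  fun_prop

/-- At precision `0` both laws are the same Dirac mass and `logRatio` vanishes, so the identity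
needs no exception for steps without a measurement. -/
theorem observationLaw_eq_withDensity {n : ℕ} (μ : ℝ) (S S' : Finset (Fin n))
    (a : SensingAction n) :
    observationLaw μ S' a = (observationLaw μ S a).withDensity fun y =>
      ENNReal.ofReal (Real.exp (logRatio μ S S' (a, y))) := by
  by_cases ha : a.2 = 0
  · simp [observationLaw, ha, logRatio]
  · simp only [observationLaw, ha, if_false, logRatio]
    rw [gaussianReal_eq_withDensity (signal μ S a.1) (signal μ S' a.1) (inv_ne_zero ha)]
    simp

theorem integrable_logRatio_observationLaw {n : ℕ} (μ : ℝ) (S S' : Finset (Fin n))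
    (a : SensingAction n) :
    Integrable (fun y => logRatio μ S S' (a, y)) (observationLaw μ S a) := by
  by_cases ha : a.2 = 0
  · simp [ha, logRatio]
  · simp only [observationLaw, ha, if_false, logRatio]
    have : Integrable (fun y : ℝ => y) (gaussianReal (signal μ S a.1) a.2⁻¹) :=
      (memLp_id_gaussianReal 1).integrable le_rfl
    exact ((this.sub (integrable_const _)).const_mul _).sub (integrable_const _)

theorem integral_logRatio_observationLaw {n : ℕ} (μ : ℝ) (S S' : Finset (Fin n))
    (a : SensingAction n) :
    ∫ y, logRatio μ S S' (a, y) ∂observationLaw μ S a =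
      -(a.2 * (signal μ S' a.1 - signal μ S a.1) ^ 2 / 2) := by
  by_cases ha : a.2 = 0
  · simp [ha, logRatio]
  · simp only [observationLaw, ha, if_false, logRatio]
    have : Integrable (fun y : ℝ => y) (gaussianReal (signal μ S a.1) a.2⁻¹) :=
      (memLp_id_gaussianReal 1).integrable le_rfl
    have hsub : Integrable (fun y : ℝ => y - signal μ S a.1)
        (gaussianReal (signal μ S a.1) a.2⁻¹) := this.sub (integrable_const _)
    rw [integral_sub (hsub.const_mul _) (integrable_const _),
      integral_const_mul, integral_sub this (integrable_const _), integral_id_gaussianReal]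
    simp

/-- The bound is affine in the precision, so a finite expected precision is enough for integrability
along the whole procedure. -/
theorem integral_norm_logRatio_observationLaw_le {n : ℕ} (μ : ℝ) (S S' : Finset (Fin n))
    (a : SensingAction n) :
    ∫ y, ‖logRatio μ S S' (a, y)‖ ∂observationLaw μ S a ≤
      1 / 2 + a.2 * (signal μ S' a.1 - signal μ S a.1) ^ 2 := by
  by_cases ha : a.2 = 0
  · simp [ha, logRatio]
  · have hint := (integrable_logRatio_observationLaw μ S S' a).norm
    simp only [observationLaw, ha, if_false, logRatio] at hint ⊢
    set d := signal μ S' a.1 - signal μ S a.1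
    set x := signal μ S a.1
    have hsq : Integrable (fun y : ℝ => (y - x) ^ 2) (gaussianReal x a.2⁻¹) :=
      ((memLp_id_gaussianReal 2).sub (memLp_const x)).integrable_sq
    have hvar : ∫ y, (y - x) ^ 2 ∂gaussianReal x a.2⁻¹ = (a.2⁻¹ : ℝ≥0) := by
      have h := variance_fun_id_gaussianReal (μ := x) (v := a.2⁻¹)
      rwa [variance_eq_integral (by fun_prop), integral_id_gaussianReal] at h
    have hG : (a.2 : ℝ) ≠ 0 := by exact_mod_cast ha
    -- AM-GM: `|t| ≤ 1 / 2 + t ^ 2 / 2` with `t = a.2 * d * (y - x)`; the variance `a.2⁻¹` then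
    -- cancels one factor of the precision.
    calc _ ≤ ∫ y, (1 / 2 + a.2 * d ^ 2 / 2 + (a.2 * d) ^ 2 / 2 * (y - x) ^ 2)
          ∂gaussianReal x a.2⁻¹ := by
          refine integral_mono hint (by fun_prop) fun y => ?_
          have h0 : (0 : ℝ) ≤ a.2 * d ^ 2 := by positivity
          simp only [Real.norm_eq_abs]
          rw [abs_le]
          constructor <;>
          nlinarith [sq_nonneg (a.2 * d * (y - x) - 1), sq_nonneg (a.2 * d * (y - x) + 1)]
      _ = _ := by
          rw [integral_add (by fun_prop) (by fun_prop), integral_const_mul, hvar]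
          simp
          field_simp
          ring

/-- The likelihood ratio of the supports `S'` and `S` for a single record. -/
noncomputable def likelihoodRatio {n : ℕ} (μ : ℝ) (S S' : Finset (Fin n)) (r : SensingRecord n) :
    ℝ≥0∞ :=
  ENNReal.ofReal (Real.exp (logRatio μ S S' r))

@[fun_prop]
theorem measurable_likelihoodRatio {n : ℕ} (μ : ℝ) (S S' : Finset (Fin n)) :
    Measurable (likelihoodRatio μ S S') := by
  unfold likelihoodRatio
  fun_prop

theorem lintegral_observationKernel_change {n : ℕ} (μ : ℝ) (S S' : Finset (Fin n))
    (a : SensingAction n) {h : ℝ → ℝ≥0∞} (hh : Measurable h) :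
    ∫⁻ y, h y ∂observationKernel μ S' a =
      ∫⁻ y, likelihoodRatio μ S S' (a, y) * h y ∂observationKernel μ S a := by
  change ∫⁻ y, h y ∂observationLaw μ S' a =
      ∫⁻ y, likelihoodRatio μ S S' (a, y) * h y ∂observationLaw μ S a
  rw [observationLaw_eq_withDensity μ S S' a, lintegral_withDensity_eq_lintegral_mul _ _ hh]
  · rfl
  · fun_prop

/-! ### Change of measure along the sequence of records. -/

namespace AdaptiveProcedure

variable {n : ℕ} (p : AdaptiveProcedure n) (μ : ℝ) (S S' : Finset (Fin n))

theorem lintegral_firstRecord_change {h : SensingRecord n → ℝ≥0∞} (hh : Measurable h) :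
    ∫⁻ r, h r ∂p.firstRecord μ S' =
      ∫⁻ r, likelihoodRatio μ S S' r * h r ∂p.firstRecord μ S := by
  unfold firstRecord
  rw [Measure.lintegral_compProd hh, Measure.lintegral_compProd (by fun_prop)]
  refine lintegral_congr fun a => ?_
  exact lintegral_observationKernel_change μ S S' a (by fun_prop)

theorem lintegral_nextRecord (j : ℕ) (x : (i : Finset.Iic j) → SensingRecord n)
    {h : SensingRecord n → ℝ≥0∞} (hh : Measurable h) :
    ∫⁻ r, h r ∂p.nextRecord μ S j x =
      ∫⁻ a, ∫⁻ y, h (a, y) ∂observationKernel μ S a ∂p.next j x := by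
  unfold nextRecord
  rw [Kernel.lintegral_compProd _ _ _ hh]
  rfl

theorem lintegral_nextRecord_change (j : ℕ) (x : (i : Finset.Iic j) → SensingRecord n)
    {h : SensingRecord n → ℝ≥0∞} (hh : Measurable h) :
    ∫⁻ r, h r ∂p.nextRecord μ S' j x =
      ∫⁻ r, likelihoodRatio μ S S' r * h r ∂p.nextRecord μ S j x := by
  rw [p.lintegral_nextRecord μ S' j x hh, p.lintegral_nextRecord μ S j x (by fun_prop)]
  refine lintegral_congr fun a => ?_
  exact lintegral_observationKernel_change μ S S' a (by fun_prop)

theorem map_law_zero : (p.law μ S).map (fun ω => ω 0) = p.firstRecord μ S := by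
  unfold law Kernel.trajMeasure
  rw [show (fun ω : ℕ → SensingRecord n => ω 0) =
      (MeasurableEquiv.piUnique (fun _ : Finset.Iic 0 => SensingRecord n)) ∘
        (Preorder.frestrictLe 0) from rfl,
    ← Measure.map_map (by fun_prop) (by fun_prop), Measure.map_comp _ _ (by fun_prop),
    Kernel.traj_map_frestrictLe, Kernel.partialTraj_self, Measure.id_comp,
    Measure.map_map (by fun_prop) (by fun_prop), MeasurableEquiv.self_comp_symm, Measure.map_id]

theorem map_law_succ (j : ℕ) :
    (p.law μ S).map (fun ω => (Preorder.frestrictLe j ω, ω (j + 1))) =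
      (p.law μ S).map (Preorder.frestrictLe j) ⊗ₘ p.nextRecord μ S j :=
  (Kernel.map_frestrictLe_trajMeasure_compProd_eq_map_trajMeasure
    (X := fun _ : ℕ => SensingRecord n)).symm

theorem lintegral_law_succ (j : ℕ)
    {h : ((i : Finset.Iic j) → SensingRecord n) × SensingRecord n → ℝ≥0∞} (hh : Measurable h) :
    ∫⁻ ω, h (Preorder.frestrictLe j ω, ω (j + 1)) ∂p.law μ S =
      ∫⁻ ω, ∫⁻ r, h (Preorder.frestrictLe j ω, r)
        ∂p.nextRecord μ S j (Preorder.frestrictLe j ω) ∂p.law μ S := by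
  have h1 := lintegral_map (μ := p.law μ S) hh
    (g := fun ω => (Preorder.frestrictLe j ω, ω (j + 1))) (by fun_prop)
  rw [← h1, map_law_succ, Measure.lintegral_compProd hh,
    lintegral_map hh.lintegral_kernel_prod_right' (by fun_prop)]

/-- Change of measure on the records of steps `0, …, T`. -/
theorem lintegral_law_change (T : ℕ) :
    ∀ {h : ((i : Finset.Iic T) → SensingRecord n) → ℝ≥0∞}, Measurable h →
    ∫⁻ ω, h (Preorder.frestrictLe T ω) ∂p.law μ S' =
      ∫⁻ ω, (∏ i ∈ Finset.range (T + 1), likelihoodRatio μ S S' (ω i)) *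
        h (Preorder.frestrictLe T ω) ∂p.law μ S := by
  induction T with
  | zero =>
    intro h hh
    let e : SensingRecord n → ((i : Finset.Iic 0) → SensingRecord n) := fun r _ => r
    have he : Measurable e := by fun_prop
    have hx : ∀ ω : ℕ → SensingRecord n, Preorder.frestrictLe 0 ω = e (ω 0) := by
      intro ω
      ext1 ⟨i, hi⟩
      obtain rfl : i = 0 := by simpa using hi
      rfl
    simp only [hx, zero_add, Finset.range_one, Finset.prod_singleton]
    have h1 := lintegral_map (μ := p.law μ S') (hh.comp he) (measurable_pi_apply 0)
    have h2 := lintegral_map (μ := p.law μ S)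
      (f := fun r => likelihoodRatio μ S S' r * h (e r)) (by fun_prop) (measurable_pi_apply 0)
    simp only [Function.comp_apply] at h1
    rw [← h1, ← h2, map_law_zero, map_law_zero]
    exact p.lintegral_firstRecord_change μ S S' (hh.comp he)
  | succ T ih =>
    intro h hh
    -- `G` appends the record of step `T + 1` to the past, which lets the one-step disintegration
    -- act on functions of the longer history.
    let G : ((i : Finset.Iic T) → SensingRecord n) × SensingRecord n →
        ((i : Finset.Iic (T + 1)) → SensingRecord n) :=
      fun q i => if hi : (i : ℕ) ≤ T then q.1 ⟨i, Finset.mem_Iic.2 hi⟩ else q.2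
    have hG : Measurable G := by
      refine measurable_pi_lambda _ fun i => ?_
      by_cases hi : (i : ℕ) ≤ T
      · simp only [G, hi, dite_true]; fun_prop
      · simp only [G, hi, dite_false]; fun_prop
    have hx : ∀ ω : ℕ → SensingRecord n,
        Preorder.frestrictLe (T + 1) ω = G (Preorder.frestrictLe T ω, ω (T + 1)) := by
      intro ω
      ext1 ⟨i, hi⟩
      by_cases hi' : i ≤ T
      · simp [G, hi']
      · obtain rfl : i = T + 1 := by have := Finset.mem_Iic.1 hi; omega
        simp [G]
    let Lx : ((i : Finset.Iic T) → SensingRecord n) → ℝ≥0∞ :=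
      fun x => ∏ i, likelihoodRatio μ S S' (x i)
    have hLx : Measurable Lx := by fun_prop
    have hL : ∀ ω : ℕ → SensingRecord n,
        ∏ i ∈ Finset.range (T + 1), likelihoodRatio μ S S' (ω i) =
          Lx (Preorder.frestrictLe T ω) := by
      intro ω
      rw [Nat.range_succ_eq_Iic, ← Finset.prod_coe_sort]
      rfl
    simp only [hx]
    rw [p.lintegral_law_succ μ S' T (h := fun q => h (G q)) (by fun_prop)]
    have hm : Measurable fun x : (i : Finset.Iic T) → SensingRecord n =>
        ∫⁻ r, h (G (x, r)) ∂p.nextRecord μ S' T x :=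
      (hh.comp hG).lintegral_kernel_prod_right'
    rw [ih hm]
    have h2 := p.lintegral_law_succ μ S T
      (h := fun q => Lx q.1 * (likelihoodRatio μ S S' q.2 * h (G q))) (by fun_prop)
    simp only [Finset.prod_range_succ _ (T + 1), hL, mul_assoc]
    rw [h2]
    refine lintegral_congr fun ω => ?_
    dsimp only
    rw [lintegral_const_mul _ (by fun_prop),
      p.lintegral_nextRecord_change μ S S' T _ (by fun_prop)]

/-- Given the action, the observation of every step follows the observation kernel. -/
theorem map_law_eval (j : ℕ) :
    (p.law μ S).map (fun ω => ω j) =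
      (p.law μ S).map (fun ω => (ω j).1) ⊗ₘ observationKernel μ S := by
  -- Any disintegration through the kernel will do: taking first marginals identifies `α` as the law
  -- of the action.
  suffices h : ∃ α : Measure (SensingAction n), IsProbabilityMeasure α ∧
      (p.law μ S).map (fun ω => ω j) = α ⊗ₘ observationKernel μ S by
    obtain ⟨α, hα, h⟩ := h
    have h1 : (p.law μ S).map (fun ω => (ω j).1) = α := by
      rw [← Measure.fst_compProd α (observationKernel μ S), ← h, Measure.fst,
        Measure.map_map (by fun_prop) (by fun_prop)]
      rfl
    rw [h1, h]
  cases j with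
  | zero => exact ⟨p.first, inferInstance, p.map_law_zero μ S⟩
  | succ j =>
    have : IsProbabilityMeasure ((p.law μ S).map (Preorder.frestrictLe j)) :=
      Measure.isProbabilityMeasure_map (by fun_prop)
    refine ⟨((p.law μ S).map (Preorder.frestrictLe j)).bind (p.next j), inferInstance, ?_⟩
    refine Measure.ext_of_lintegral _ fun h hh => ?_
    have h1 := lintegral_map (μ := p.law μ S) hh (measurable_pi_apply (j + 1))
    have h2 := p.lintegral_law_succ μ S j (h := fun q => h q.2) (by fun_prop)
    have h3 : Measurable fun a : SensingAction n => ∫⁻ y, h (a, y) ∂observationKernel μ S a :=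
      hh.lintegral_kernel_prod_right'
    rw [h1, h2, Measure.lintegral_compProd hh,
      Measure.lintegral_bind (Kernel.aemeasurable _) h3.aemeasurable,
      lintegral_map (h3.lintegral_kernel (κ := p.next j)) (by fun_prop)]
    exact lintegral_congr fun ω => p.lintegral_nextRecord μ S j _ hh

end AdaptiveProcedure

/-! ### Testing two supports under a precision budget. -/

/-- Both bounds come from `x + 1 ≤ exp x`, at `x` and at `x - log c`. Being affine in `x` and `exp
x`, the left side integrates explicitly when `x` is a log-likelihood ratio. -/
theorem tangent_le_min_one_exp {c : ℝ} (hc : 0 < c) (x : ℝ) :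
    c * (1 - Real.log c + x - Real.exp x) ≤ min 1 (Real.exp x) := by
  refine le_min ?_ ?_
  · have h1 : 1 - c⁻¹ ≤ Real.log c := Real.one_sub_inv_le_log_of_pos hc
    have h2 : x + 1 ≤ Real.exp x := Real.add_one_le_exp x
    have h3 : c * (1 - Real.log c + x - Real.exp x) ≤ c * (c⁻¹ - 1) :=
      mul_le_mul_of_nonneg_left (by linarith) hc.le
    have h4 : c * (c⁻¹ - 1) = 1 - c := by field_simp
    linarith
  · have h1 : x - Real.log c + 1 ≤ Real.exp (x - Real.log c) := Real.add_one_le_exp _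
    rw [Real.exp_sub, Real.exp_log hc, le_div_iff₀ hc] at h1
    nlinarith [mul_pos hc (Real.exp_pos x)]

namespace AdaptiveProcedure

variable {n : ℕ} (p : AdaptiveProcedure n) (μ : ℝ) (S S' : Finset (Fin n))

/-- The expected precision spent on the coordinates in `I`. -/
noncomputable def expectedPrecisionOn (I : Finset (Fin n)) : ℝ≥0∞ :=
  ∫⁻ ω, ∑' j : ℕ, (if (ω j).1.1 ∈ I then ((ω j).1.2 : ℝ≥0∞) else 0) ∂p.law μ S

theorem measurableSet_coordinate_mem (I : Finset (Fin n)) (j : ℕ) :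
    MeasurableSet {ω : ℕ → SensingRecord n | (ω j).1.1 ∈ I} := by
  have : Measurable fun ω : ℕ → SensingRecord n => (ω j).1.1 := by fun_prop
  exact this (MeasurableSet.of_discrete (s := {i | i ∈ I}))

@[fun_prop]
theorem measurable_precisionOn (I : Finset (Fin n)) (j : ℕ) :
    Measurable fun ω : ℕ → SensingRecord n =>
      if (ω j).1.1 ∈ I then ((ω j).1.2 : ℝ≥0∞) else 0 :=
  Measurable.ite (measurableSet_coordinate_mem I j) (by fun_prop) measurable_const

theorem sum_expectedPrecisionOn_le {ι : Type*} (t : Finset ι) (I : ι → Finset (Fin n))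
    (hI : ∀ i j, i ≠ j → Disjoint (I i) (I j)) :
    ∑ b ∈ t, p.expectedPrecisionOn μ S (I b) ≤ p.expectedPrecision μ S := by
  unfold expectedPrecisionOn expectedPrecision
  rw [← lintegral_finsetSum _ fun b _ => Measurable.tsum fun j => by fun_prop]
  refine lintegral_mono fun ω => ?_
  rw [← Summable.tsum_finsetSum fun _ _ => ENNReal.summable]
  refine ENNReal.tsum_le_tsum fun j => ?_
  by_cases h : ∃ b ∈ t, (ω j).1.1 ∈ I b
  · obtain ⟨b, hb, hbI⟩ := h
    rw [Finset.sum_eq_single_of_mem b hb]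
    · simp [hbI]
    · intro b' _ hne
      rw [if_neg]
      exact fun h' => Finset.disjoint_left.1 (hI _ _ hne) h' hbI
  · push Not at h
    rw [Finset.sum_eq_zero fun b hb => if_neg (h b hb)]
    exact zero_le

theorem integrable_precision (hfin : p.expectedPrecision μ S ≠ ∞) (j : ℕ) :
    Integrable (fun ω => ((ω j).1.2 : ℝ)) (p.law μ S) := by
  refine ⟨Measurable.aestronglyMeasurable (by fun_prop), ?_⟩
  refine lt_of_le_of_lt ?_ hfin.lt_top
  refine lintegral_mono fun ω => ?_
  simp only [NNReal.enorm_eq]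
  exact ENNReal.le_tsum (f := fun j => ((ω j).1.2 : ℝ≥0∞)) j

theorem integrable_logRatio_law (hfin : p.expectedPrecision μ S ≠ ∞) (j : ℕ) :
    Integrable (fun ω => logRatio μ S S' (ω j)) (p.law μ S) := by
  have hm : Measurable fun ω : ℕ → SensingRecord n => ω j := by fun_prop
  have hG := p.integrable_precision μ S hfin j
  have hG' : Integrable (fun a : SensingAction n => (a.2 : ℝ))
      ((p.law μ S).map fun ω => (ω j).1) :=
    (integrable_map_measure (Measurable.aestronglyMeasurable (by fun_prop))
      (Measurable.aemeasurable (by fun_prop))).2 hG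
  have : Integrable (logRatio μ S S') ((p.law μ S).map fun ω => ω j) := by
    rw [map_law_eval, Measure.integrable_compProd_iff (by fun_prop)]
    refine ⟨.of_forall fun a => integrable_logRatio_observationLaw μ S S' a, ?_⟩
    have hb : ∀ i, (signal μ S' i - signal μ S i) ^ 2 ≤ μ ^ 2 := by
      intro i
      unfold signal
      split_ifs <;> simp [sq_nonneg]
    refine Integrable.mono' (g := fun a => 1 / 2 + (a.2 : ℝ) * μ ^ 2)
      ((integrable_const _).add (hG'.mul_const _)) ?_ (.of_forall fun a => ?_)
    · exact ((measurable_logRatio μ S S').norm.stronglyMeasurable.integral_kernel_prod_right'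
        (κ := observationKernel μ S)).aestronglyMeasurable
    · rw [Real.norm_of_nonneg (integral_nonneg fun _ => norm_nonneg _)]
      refine (integral_norm_logRatio_observationLaw_le μ S S' a).trans ?_
      exact add_le_add le_rfl (mul_le_mul_of_nonneg_left (hb _) a.2.2)
  exact (integrable_map_measure (by fun_prop) hm.aemeasurable).1 this

theorem integral_logRatio_law (hfin : p.expectedPrecision μ S ≠ ∞) (j : ℕ) :
    ∫ ω, logRatio μ S S' (ω j) ∂p.law μ S =
      -∫ ω, ((ω j).1.2 : ℝ) * (signal μ S' (ω j).1.1 - signal μ S (ω j).1.1) ^ 2 / 2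
        ∂p.law μ S := by
  have hint := p.integrable_logRatio_law μ S S' hfin j
  have hint' : Integrable (logRatio μ S S') ((p.law μ S).map fun ω => ω j) :=
    (integrable_map_measure (measurable_logRatio μ S S').aestronglyMeasurable (measurable_pi_apply j).aemeasurable).2 hint
  have h1 := integral_map (μ := p.law μ S) (φ := fun ω => ω j) (measurable_pi_apply j).aemeasurable
    (hint'.aestronglyMeasurable)
  rw [← h1]
  rw [map_law_eval] at hint' ⊢
  rw [Measure.integral_compProd hint', ← integral_neg]
  have hm : ∀ S : Finset (Fin n), Measurable fun a : SensingAction n => signal μ S a.1 :=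
    fun S => (measurable_of_countable (signal μ S)).comp measurable_fst
  have := hm S
  have := hm S'
  rw [← integral_map (φ := fun ω : ℕ → SensingRecord n => (ω j).1)
    (f := fun a => -(((a.2 : ℝ≥0) : ℝ) * (signal μ S' a.1 - signal μ S a.1) ^ 2 / 2))
    (Measurable.aemeasurable (by fun_prop)) (Measurable.aestronglyMeasurable (by fun_prop))]
  exact integral_congr_ae (.of_forall fun a => integral_logRatio_observationLaw μ S S' a)

/-- A Kullback–Leibler bound independent of the number of steps: the divergence of the first records
is controlled by the total precision spent where the signals differ. -/
theorem neg_sum_integral_logRatio_le {I : Finset (Fin n)}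
    (hI : ∀ i, (signal μ S' i - signal μ S i) ^ 2 = if i ∈ I then μ ^ 2 else 0)
    (hfin : p.expectedPrecision μ S ≠ ∞) (t : Finset ℕ) :
    -∑ j ∈ t, ∫ ω, logRatio μ S S' (ω j) ∂p.law μ S ≤
      μ ^ 2 / 2 * (p.expectedPrecisionOn μ S I).toReal := by
  have hon : p.expectedPrecisionOn μ S I ≠ ∞ := by
    refine ne_top_of_le_ne_top hfin ?_
    simpa using p.sum_expectedPrecisionOn_le μ S {()} (fun _ => I) (by simp)
  have hterm : ∀ j, ∫ ω, logRatio μ S S' (ω j) ∂p.law μ S =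
      -(μ ^ 2 / 2 * (∫⁻ ω, (if (ω j).1.1 ∈ I then ((ω j).1.2 : ℝ≥0∞) else 0)
        ∂p.law μ S).toReal) := by
    intro j
    rw [p.integral_logRatio_law μ S S' hfin, ← integral_toReal (by fun_prop) (.of_forall _),
      ← integral_const_mul]
    · congr 2
      ext ω
      rw [hI]
      split_ifs <;> simp
      ring
    · intro ω
      split_ifs <;> simp
  simp only [hterm, Finset.sum_neg_distrib, neg_neg, ← Finset.mul_sum]
  refine mul_le_mul_of_nonneg_left ?_ (by positivity)
  have hle : ∑ j ∈ t, ∫⁻ ω, (if (ω j).1.1 ∈ I then ((ω j).1.2 : ℝ≥0∞) else 0) ∂p.law μ S ≤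
      p.expectedPrecisionOn μ S I := by
    rw [← lintegral_finsetSum _ fun j _ => by fun_prop]
    exact lintegral_mono fun ω => ENNReal.sum_le_tsum t
  rw [← ENNReal.toReal_sum]
  · exact ENNReal.toReal_mono hon hle
  · intro j hj
    exact ne_top_of_le_ne_top hon ((Finset.single_le_sum (fun _ _ => zero_le) hj).trans hle)

/-- A lower bound for the sum of the error probabilities of a test that uses finitely many
records. -/
theorem le_measureReal_add_measureReal_compl_of_cylinder {I : Finset (Fin n)}
    (hI : ∀ i, (signal μ S' i - signal μ S i) ^ 2 = if i ∈ I then μ ^ 2 else 0)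
    (hfin : p.expectedPrecision μ S ≠ ∞) {c : ℝ} (hc : 0 < c) (T : ℕ)
    {B : Set ((i : Finset.Iic T) → SensingRecord n)} (hB : MeasurableSet B) :
    c * (-Real.log c - μ ^ 2 / 2 * (p.expectedPrecisionOn μ S I).toReal) ≤
      (p.law μ S).real (Preorder.frestrictLe T ⁻¹' B) +
        (p.law μ S').real (Preorder.frestrictLe T ⁻¹' B)ᶜ := by
  set A : Set (ℕ → SensingRecord n) := Preorder.frestrictLe T ⁻¹' B with hA
  have hAm : MeasurableSet A := hB.preimage (by fun_prop)
  let l : (ℕ → SensingRecord n) → ℝ := fun ω =>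
    ∑ j ∈ Finset.range (T + 1), logRatio μ S S' (ω j)
  have hlm : Measurable l := by fun_prop
  have hL : ∀ ω : ℕ → SensingRecord n,
      ∏ i ∈ Finset.range (T + 1), likelihoodRatio μ S S' (ω i) =
        ENNReal.ofReal (Real.exp (l ω)) := by
    intro ω
    rw [Real.exp_sum, ENNReal.ofReal_prod_of_nonneg fun _ _ => (Real.exp_pos _).le]
    rfl
  have hl : Integrable l (p.law μ S) :=
    integrable_finsetSum _ fun j _ => p.integrable_logRatio_law μ S S' hfin j
  have hlint : -∫ ω, l ω ∂p.law μ S ≤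
      μ ^ 2 / 2 * (p.expectedPrecisionOn μ S I).toReal := by
    rw [integral_finsetSum _ fun j _ => p.integrable_logRatio_law μ S S' hfin j]
    exact p.neg_sum_integral_logRatio_le μ S S' hI hfin _
  have h1 : ∫⁻ ω, ENNReal.ofReal (Real.exp (l ω)) ∂p.law μ S = 1 := by
    have := p.lintegral_law_change μ S S' T (h := fun _ => 1) measurable_const
    simp only [hL, mul_one, lintegral_const, measure_univ] at this
    exact this.symm
  have he : Integrable (fun ω => Real.exp (l ω)) (p.law μ S) := by
    refine ⟨by fun_prop, ?_⟩
    rw [hasFiniteIntegral_iff_ofReal (.of_forall fun ω => (Real.exp_pos _).le), h1]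
    exact ENNReal.one_lt_top
  have heint : ∫ ω, Real.exp (l ω) ∂p.law μ S = 1 := by
    rw [integral_eq_lintegral_of_nonneg_ae (.of_forall fun ω => (Real.exp_pos _).le)
      (by fun_prop), h1, ENNReal.toReal_one]
  -- Both error probabilities become integrals under the law of `S`, with integrand `1` on `A` and
  -- `exp (l ω)` on `Aᶜ`, hence at least `min 1 (exp (l ω))`.
  have h2 : (p.law μ S').real Aᶜ = ∫ ω in Aᶜ, Real.exp (l ω) ∂p.law μ S := by
    have := p.lintegral_law_change μ S S' T (h := Bᶜ.indicator 1)
      (measurable_one.indicator hB.compl)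
    have hind : ∀ ω : ℕ → SensingRecord n, Bᶜ.indicator (1 : ((i : Finset.Iic T) → SensingRecord n) → ℝ≥0∞)
        (Preorder.frestrictLe T ω) = Aᶜ.indicator 1 ω := fun ω => rfl
    simp only [hL, hind] at this
    rw [lintegral_indicator_one hAm.compl] at this
    rw [Measure.real, this, integral_eq_lintegral_of_nonneg_ae
      (.of_forall fun ω => (Real.exp_pos _).le) (by fun_prop), ← lintegral_indicator hAm.compl]
    congr 2
    ext ω
    by_cases hω : ω ∈ Aᶜ <;> simp [Set.indicator, hω]
  have h3 : (p.law μ S).real A = ∫ ω in A, (1 : ℝ) ∂p.law μ S := by simp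
  rw [h2, h3, ← integral_indicator hAm, ← integral_indicator hAm.compl,
    ← integral_add ((integrable_const _).indicator hAm) (he.indicator hAm.compl)]
  calc _ ≤ ∫ ω, c * (1 - Real.log c + l ω - Real.exp (l ω)) ∂p.law μ S := by
        have hadd : Integrable (fun ω => 1 - Real.log c + l ω) (p.law μ S) :=
          (integrable_const _).add hl
        -- The likelihood ratio has mean `1`, which cancels the `1` of the tangent bound.
        rw [integral_const_mul, integral_sub hadd he,
          integral_add (integrable_const _) hl, heint]
        refine mul_le_mul_of_nonneg_left ?_ hc.le
        simp
        linarith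
    _ ≤ _ := by
        refine integral_mono ((((integrable_const _).add hl).sub he).const_mul _)
          (((integrable_const _).indicator hAm).add (he.indicator hAm.compl)) fun ω => ?_
        have h := tangent_le_min_one_exp hc (l ω)
        by_cases hω : ω ∈ A
        · simpa [hω] using h.trans (min_le_left _ _)
        · simpa [hω] using h.trans (min_le_right _ _)

/-- A lower bound for the sum of the error probabilities of a test. -/
theorem le_measureReal_add_measureReal_compl {I : Finset (Fin n)}
    (hI : ∀ i, (signal μ S' i - signal μ S i) ^ 2 = if i ∈ I then μ ^ 2 else 0)
    (hfin : p.expectedPrecision μ S ≠ ∞) {c : ℝ} (hc : 0 < c)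
    {A : Set (ℕ → SensingRecord n)} (hA : MeasurableSet A) :
    c * (-Real.log c - μ ^ 2 / 2 * (p.expectedPrecisionOn μ S I).toReal) ≤
      (p.law μ S).real A + (p.law μ S').real Aᶜ := by
  refine le_of_forall_pos_le_add fun δ hδ => ?_
  -- The cylinder bound does not depend on the horizon, so it passes to every event by
  -- approximation. Using the sum of the two laws makes one cylinder close to `A` under both.
  obtain ⟨B, hBmem, hB⟩ := exists_measure_symmDiff_lt_of_generateFrom_isSetRing
    (μ := p.law μ S + p.law μ S')
    (isSetRing_measurableCylinders (α := fun _ : ℕ => SensingRecord n))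
    ⟨{Set.univ}, Set.countable_singleton _,
      Set.singleton_subset_iff.2 (univ_mem_measurableCylinders _), by simp⟩
    generateFrom_measurableCylinders.symm hA (ε := ENNReal.ofReal δ) (by simpa using hδ)
  rw [measurableCylinders_nat] at hBmem
  simp only [Set.mem_iUnion, Set.mem_singleton_iff] at hBmem
  obtain ⟨T, C, hC, hBC⟩ := hBmem
  have h := p.le_measureReal_add_measureReal_compl_of_cylinder μ S S' hI hfin hc T hC
  rw [show Preorder.frestrictLe T ⁻¹' C = B from hBC.symm] at h
  have hreal : (p.law μ S).real (symmDiff B A) + (p.law μ S').real (symmDiff B A) ≤ δ := by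
    rw [← measureReal_add_apply, Measure.real]
    exact ENNReal.toReal_le_of_le_ofReal hδ.le hB.le
  have hS : (p.law μ S).real B ≤ (p.law μ S).real A + (p.law μ S).real (symmDiff B A) := by
    refine (measureReal_mono ?_).trans (measureReal_union_le _ _)
    intro ω hω
    by_cases h : ω ∈ A
    · exact Or.inl h
    · exact Or.inr (Or.inl ⟨hω, h⟩)
  have hS' : (p.law μ S').real Bᶜ ≤
      (p.law μ S').real Aᶜ + (p.law μ S').real (symmDiff B A) := by
    refine (measureReal_mono ?_).trans (measureReal_union_le _ _)
    intro ω hω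
    by_cases h : ω ∈ A
    · exact Or.inr (Or.inr ⟨h, hω⟩)
    · exact Or.inl h
  linarith

end AdaptiveProcedure

/-! ### Averaging over sets of blocks. -/

/-- Double counting: a set with a marked element corresponds to the set without it together with an
outside element. -/
theorem sum_powersetCard_succ_eq {ι : Type*} [Fintype ι] [DecidableEq ι] (r : ℕ)
    (f : Finset ι → ι → ℝ) :
    ∑ B ∈ Finset.powersetCard (r + 1) Finset.univ, ∑ b ∈ B, f B b =
      ∑ B ∈ Finset.powersetCard r Finset.univ, ∑ b ∈ Bᶜ, f (insert b B) b := by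
  rw [Finset.sum_sigma', Finset.sum_sigma']
  symm
  refine Finset.sum_bij' (fun x _ => ⟨insert x.2 x.1, x.2⟩) (fun x _ => ⟨x.1.erase x.2, x.2⟩)
    ?_ ?_ ?_ ?_ ?_
  · rintro ⟨B, b⟩ h
    simp only [Finset.mem_sigma, Finset.mem_powersetCard_univ, Finset.mem_compl] at h
    simp [Finset.card_insert_of_notMem h.2, h.1]
  · rintro ⟨B, b⟩ h
    simp only [Finset.mem_sigma, Finset.mem_powersetCard_univ] at h
    simp [Finset.card_erase_of_mem h.2, h.1]
  · rintro ⟨B, b⟩ h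
    simp only [Finset.mem_sigma, Finset.mem_powersetCard_univ, Finset.mem_compl] at h
    simp [Finset.erase_insert h.2]
  · rintro ⟨B, b⟩ h
    simp only [Finset.mem_sigma, Finset.mem_powersetCard_univ] at h
    simp [Finset.insert_erase h.2]
  · rintro ⟨B, b⟩ _
    rfl

/-- Averaging over all pairs of an `r`-element set `B` and a point `b` outside it. -/
theorem le_of_pairwise_le_insert {ι : Type*} [Fintype ι] [DecidableEq ι] {r N : ℕ} (hN : 0 < N)
    (hcard : Fintype.card ι = r + N) (e D : Finset ι → ι → ℝ) {a κ m ε : ℝ} (hκ : 0 ≤ κ)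
    (hlow : ∀ B, B.card = r → ∑ b ∈ Bᶜ, e B b ≤ ε)
    (hhigh : ∀ B, B.card = r + 1 → ∑ b ∈ B, e B b ≤ ε)
    (hD : ∀ B, B.card = r → ∑ b ∈ Bᶜ, D B b ≤ m)
    (hpair : ∀ B, B.card = r → ∀ b ∉ B, a - κ * D B b ≤ e B b + e (insert b B) b) :
    a - κ * (m / N) ≤ ε * (1 / N + 1 / (r + 1)) := by
  have hchoose : ((r + N).choose (r + 1) : ℝ) * (r + 1) = (r + N).choose r * N := by
    have := Nat.choose_succ_right_eq (r + N) r
    rw [Nat.add_sub_cancel_left] at this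
    exact_mod_cast this
  have hpos : (0 : ℝ) < (r + N).choose r := by
    exact_mod_cast Nat.choose_pos (Nat.le_add_right r N)
  have hlower : ((r + N).choose r : ℝ) * (N * a - κ * m) ≤
      ∑ B ∈ Finset.powersetCard r (Finset.univ : Finset ι),
        ∑ b ∈ Bᶜ, (e B b + e (insert b B) b) := by
    rw [← hcard, ← Finset.card_univ, ← Finset.card_powersetCard, ← nsmul_eq_mul]
    refine Finset.card_nsmul_le_sum _ _ _ fun B hB => ?_
    rw [Finset.mem_powersetCard_univ] at hB
    have hc : Bᶜ.card = N := by rw [Finset.card_compl, hcard, hB]; omega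
    calc N * a - κ * m ≤ N * a - κ * ∑ b ∈ Bᶜ, D B b := by
          have := mul_le_mul_of_nonneg_left (hD B hB) hκ
          linarith
      _ = ∑ b ∈ Bᶜ, (a - κ * D B b) := by
          rw [Finset.sum_sub_distrib, Finset.mul_sum, Finset.sum_const, hc, nsmul_eq_mul]
      _ ≤ _ := Finset.sum_le_sum fun b hb => hpair B hB b (Finset.mem_compl.1 hb)
  have hupper : ∑ B ∈ Finset.powersetCard r (Finset.univ : Finset ι),
        ∑ b ∈ Bᶜ, (e B b + e (insert b B) b) ≤
      (r + N).choose r * ε + (r + N).choose (r + 1) * ε := by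
    simp only [Finset.sum_add_distrib]
    rw [← sum_powersetCard_succ_eq, ← hcard, ← Finset.card_univ, ← Finset.card_powersetCard,
      ← Finset.card_powersetCard, ← nsmul_eq_mul, ← nsmul_eq_mul]
    refine add_le_add (Finset.sum_le_card_nsmul _ _ _ fun B hB => ?_)
      (Finset.sum_le_card_nsmul _ _ _ fun B hB => ?_)
    · exact hlow B (Finset.mem_powersetCard_univ.1 hB)
    · exact hhigh B (Finset.mem_powersetCard_univ.1 hB)
  have hN' : (0 : ℝ) < N := by exact_mod_cast hN
  -- There are `N / (r + 1)` times as many large sets as small ones, which is the source of the term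
  -- `1 / (r + 1)`.
  have hch : ((r + N).choose (r + 1) : ℝ) = (r + N).choose r * N / (r + 1) := by
    rw [eq_div_iff (by positivity), hchoose]
  have h := hlower.trans hupper
  rw [hch] at h
  have h2 : ((r + N).choose r : ℝ) * (N * a - κ * m) ≤
      (r + N).choose r * (ε + N / (r + 1) * ε) := h.trans_eq (by ring)
  have h3 := le_of_mul_le_mul_left h2 hpos
  calc a - κ * (m / N) = (N * a - κ * m) / N := by field_simp
    _ ≤ (ε + N / (r + 1) * ε) / N := by gcongr
    _ = _ := by field_simp

/-! ### Blocks as a disjoint family of `s`-intervals. -/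

/-- The `b`-th of the consecutive `s`-intervals that start at the first coordinate. -/
def block (n s : ℕ) (b : Fin (n / s)) : Finset (Fin n) :=
  Finset.univ.filter fun a => (b : ℕ) * s ≤ a ∧ (a : ℕ) < b * s + s

theorem block_end_le {n s : ℕ} (b : Fin (n / s)) : (b : ℕ) * s + s ≤ n := by
  calc (b : ℕ) * s + s = (b + 1) * s := by ring
    _ ≤ n / s * s := Nat.mul_le_mul_right _ b.2
    _ ≤ n := Nat.div_mul_le_self n s

theorem isSInterval_block {n s : ℕ} (b : Fin (n / s)) : IsSInterval n s (block n s b) :=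
  ⟨b * s, block_end_le b, fun a => by simp [block]⟩

theorem card_block {n s : ℕ} (b : Fin (n / s)) : (block n s b).card = s := by
  have h : (block n s b).map Fin.valEmbedding = Finset.Ico ((b : ℕ) * s) (b * s + s) := by
    ext a
    simp only [block, Finset.mem_map, Finset.mem_filter, Finset.mem_univ, true_and,
      Fin.valEmbedding_apply, Finset.mem_Ico]
    constructor
    · rintro ⟨x, hx, rfl⟩
      exact hx
    · intro ha
      exact ⟨⟨a, ha.2.trans_le (block_end_le b)⟩, ha, rfl⟩
  rw [← Finset.card_map Fin.valEmbedding, h, Nat.card_Ico, Nat.add_sub_cancel_left]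

theorem disjoint_block {n s : ℕ} {b b' : Fin (n / s)} (h : b ≠ b') :
    Disjoint (block n s b) (block n s b') := by
  rw [Finset.disjoint_left]
  intro a ha ha'
  simp only [block, Finset.mem_filter, Finset.mem_univ, true_and] at ha ha'
  apply h
  ext
  rcases lt_trichotomy (b : ℕ) b' with hlt | heq | hlt
  · have := Nat.mul_le_mul_right s (Nat.succ_le_of_lt hlt)
    rw [Nat.succ_mul] at this
    omega
  · exact heq
  · have := Nat.mul_le_mul_right s (Nat.succ_le_of_lt hlt)
    rw [Nat.succ_mul] at this
    omega

theorem isDisjointUnionOfSIntervals_biUnion_block {n s r : ℕ} {B : Finset (Fin (n / s))}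
    (hB : B.card = r) : IsDisjointUnionOfSIntervals n s r (B.biUnion (block n s)) := by
  let e := B.orderIsoOfFin hB
  refine ⟨fun l => block n s (e l), fun l => isSInterval_block _, fun l l' h => ?_, ?_⟩
  · exact disjoint_block fun h' => h (e.injective (Subtype.ext h'))
  · ext a
    simp only [Finset.mem_biUnion, Finset.mem_univ, true_and]
    constructor
    · rintro ⟨b, hb, ha⟩
      exact ⟨e.symm ⟨b, hb⟩, by simpa using ha⟩
    · rintro ⟨l, ha⟩
      exact ⟨e l, (e l).2, ha⟩

theorem mem_biUnion_block_iff {n s : ℕ} {B : Finset (Fin (n / s))} {b : Fin (n / s)} {i : Fin n}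
    (hi : i ∈ block n s b) : i ∈ B.biUnion (block n s) ↔ b ∈ B := by
  rw [Finset.mem_biUnion]
  refine ⟨?_, fun h => ⟨b, h, hi⟩⟩
  rintro ⟨b', hb', hi'⟩
  by_cases h : b = b'
  · exact h ▸ hb'
  · exact absurd hi' (Finset.disjoint_left.1 (disjoint_block h) hi)

theorem signal_insert_block_sub_sq {n s : ℕ} (μ : ℝ) {B : Finset (Fin (n / s))}
    {b : Fin (n / s)} (hb : b ∉ B) (i : Fin n) :
    (signal μ ((insert b B).biUnion (block n s)) i - signal μ (B.biUnion (block n s)) i) ^ 2 =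
      if i ∈ block n s b then μ ^ 2 else 0 := by
  by_cases hi : i ∈ block n s b
  · simp [signal, hi, mem_biUnion_block_iff hi, hb, -Finset.mem_biUnion]
  · simp [signal, hi, -Finset.mem_biUnion]

/-! ### From the Hamming risk to tests on coordinates. -/

namespace AdaptiveProcedure

variable {n : ℕ} (p : AdaptiveProcedure n) (μ : ℝ)

theorem measurableSet_mem_estimator (i : Fin n) : MeasurableSet {ω | i ∈ p.estimator ω} :=
  p.measurable_estimator (MeasurableSet.of_discrete (s := {S | i ∈ S}))

/-- The probability that the coordinate `i` is misclassified. -/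
noncomputable def errorAt (S : Finset (Fin n)) (i : Fin n) : ℝ :=
  (p.law μ S).real {ω | i ∈ symmDiff (p.estimator ω) S}

theorem sum_errorAt_le {S : Finset (Fin n)} {ε : ℝ} (hε : 0 ≤ ε)
    (h : p.expectedHamming μ S ≤ ENNReal.ofReal ε) (t : Finset (Fin n)) :
    ∑ i ∈ t, p.errorAt μ S i ≤ ε := by
  have hm : ∀ i, MeasurableSet {ω | i ∈ symmDiff (p.estimator ω) S} := fun i =>
    p.measurable_estimator (MeasurableSet.of_discrete (s := {T | i ∈ symmDiff T S}))
  have h1 : p.expectedHamming μ S = ∑ i, p.law μ S {ω | i ∈ symmDiff (p.estimator ω) S} := by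
    unfold expectedHamming
    simp_rw [← lintegral_indicator_one (hm _)]
    rw [← lintegral_finsetSum _ fun i _ => measurable_one.indicator (hm i)]
    refine lintegral_congr fun ω => ?_
    simp [Set.indicator_apply]
  calc ∑ i ∈ t, p.errorAt μ S i ≤ ∑ i, p.errorAt μ S i :=
        Finset.sum_le_sum_of_subset_of_nonneg (Finset.subset_univ _)
          fun _ _ _ => measureReal_nonneg
    _ = (p.expectedHamming μ S).toReal := by
        rw [h1, ENNReal.toReal_sum fun _ _ => measure_ne_top _ _]
        rfl
    _ ≤ ε := ENNReal.toReal_le_of_le_ofReal hε h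

theorem le_errorAt_add_errorAt_insert_block {s : ℕ} {B : Finset (Fin (n / s))}
    {b : Fin (n / s)} (hb : b ∉ B)
    (hfin : p.expectedPrecision μ (B.biUnion (block n s)) ≠ ∞) {c : ℝ} (hc : 0 < c)
    {i : Fin n} (hi : i ∈ block n s b) :
    c * (-Real.log c - μ ^ 2 / 2 *
        (p.expectedPrecisionOn μ (B.biUnion (block n s)) (block n s b)).toReal) ≤
      p.errorAt μ (B.biUnion (block n s)) i +
        p.errorAt μ ((insert b B).biUnion (block n s)) i := by
  refine (p.le_measureReal_add_measureReal_compl μ _ ((insert b B).biUnion (block n s))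
    (signal_insert_block_sub_sq μ hb) hfin hc (p.measurableSet_mem_estimator i)).trans_eq ?_
  -- Off the smaller support an error at `i` means `i` is selected; on the larger one it means `i`
  -- is missed. These are complementary events.
  have h0 : i ∉ B.biUnion (block n s) := (mem_biUnion_block_iff hi).not.2 hb
  have h1 : i ∈ (insert b B).biUnion (block n s) :=
    (mem_biUnion_block_iff hi).2 (Finset.mem_insert_self b B)
  unfold errorAt
  congr 2
  · ext ω
    simp [Finset.mem_symmDiff, h0, -Finset.mem_biUnion]
  · ext ω
    simp [Finset.mem_symmDiff, h1, -Finset.mem_biUnion, -Finset.biUnion_insert]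

theorem block_error_bound {s k : ℕ} (hk : 1 ≤ k) (hkn : k ≤ n / s)
    {m ε : ℝ} (hm : 0 < m) (hε : 0 < ε)
    (hbudget : ∀ S ∈ unionIntervalClass n s k, p.expectedPrecision μ S ≤ ENNReal.ofReal m)
    (herror : ∀ S ∈ unionIntervalClass n s k, p.expectedHamming μ S ≤ ENNReal.ofReal ε) :
    s * Real.exp (-1 - μ ^ 2 / 2 * (m / (n / s + 1 - k : ℕ))) ≤
      ε * (1 / (n / s + 1 - k : ℕ) + 1 / k) := by
  obtain ⟨r, rfl⟩ : ∃ r, k = r + 1 := ⟨k - 1, by omega⟩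
  set N := n / s + 1 - (r + 1) with hNdef
  have hN : 0 < N := by omega
  have hcard : Fintype.card (Fin (n / s)) = r + N := by rw [Fintype.card_fin]; omega
  have hclass : ∀ B : Finset (Fin (n / s)), B.card = r + 1 ∨ B.card = r →
      B.biUnion (block n s) ∈ unionIntervalClass n s (r + 1) := fun B hB =>
    hB.imp isDisjointUnionOfSIntervals_biUnion_block isDisjointUnionOfSIntervals_biUnion_block
  -- This `c` maximizes `c * (-log c - K)` at `K = μ ^ 2 / 2 * (m / N)`; the maximum equals `c`
  -- itself.
  set c := Real.exp (-1 - μ ^ 2 / 2 * (m / N)) with hcdef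
  have hc : 0 < c := Real.exp_pos _
  have hlog : Real.log c = -1 - μ ^ 2 / 2 * (m / N) := Real.log_exp _
  have herr : ∀ B : Finset (Fin (n / s)), B.card = r + 1 ∨ B.card = r →
      ∀ t : Finset (Fin (n / s)),
      ∑ b ∈ t, ∑ i ∈ block n s b, p.errorAt μ (B.biUnion (block n s)) i ≤ ε := by
    intro B hB t
    rw [← Finset.sum_biUnion fun b _ b' _ h => disjoint_block h]
    exact p.sum_errorAt_le μ hε.le (herror _ (hclass B hB)) _
  have key := le_of_pairwise_le_insert hN hcard
    (fun B b => ∑ i ∈ block n s b, p.errorAt μ (B.biUnion (block n s)) i)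
    (fun B b => (p.expectedPrecisionOn μ (B.biUnion (block n s)) (block n s b)).toReal)
    (a := s * (c * -Real.log c)) (κ := s * (c * (μ ^ 2 / 2))) (m := m) (ε := ε)
    (by positivity) (fun B hB => herr B (.inr hB) _) (fun B hB => herr B (.inl hB) _)
    (fun B hB => ?_) fun B hB b hb => ?_
  · have h : s * (c * -Real.log c) - s * (c * (μ ^ 2 / 2)) * (m / N) = s * c := by
      rw [hlog]; ring
    rw [h] at key
    exact_mod_cast key
  · have hle := (p.sum_expectedPrecisionOn_le μ (B.biUnion (block n s)) Bᶜ (block n s)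
      fun _ _ => disjoint_block).trans (hbudget _ (hclass B (.inr hB)))
    rw [← ENNReal.toReal_sum fun b hb => ne_top_of_le_ne_top ENNReal.ofReal_ne_top
      ((Finset.single_le_sum (fun _ _ => zero_le) hb).trans hle)]
    exact ENNReal.toReal_le_of_le_ofReal hm.le hle
  · have hfin : p.expectedPrecision μ (B.biUnion (block n s)) ≠ ∞ :=
      ne_top_of_le_ne_top ENNReal.ofReal_ne_top (hbudget _ (hclass B (.inr hB)))
    have h := Finset.card_nsmul_le_sum (block n s b) _ _ fun i hi =>
      p.le_errorAt_add_errorAt_insert_block μ hb hfin hc hi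
    rw [card_block, nsmul_eq_mul, Finset.sum_add_distrib] at h
    refine le_trans (le_of_eq ?_) h
    ring

end AdaptiveProcedure

/-! ### Solving for the amplitude. -/

theorem proposition16 (n s k : ℕ) (hs : 1 ≤ s) (hk : 1 ≤ k) (hskn : s * k < n)
    (m μ ε : ℝ) (hm : 0 < m) (hμ : 0 < μ) (hε0 : 0 < ε) (hε1 : ε < 1)
    (p : AdaptiveProcedure n)
    (hbudget : ∀ S ∈ unionIntervalClass n s k, p.expectedPrecision μ S ≤ ENNReal.ofReal m)
    (herror : ∀ S ∈ unionIntervalClass n s k, p.expectedHamming μ S ≤ ENNReal.ofReal ε) :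
    √(2 * ((n : ℝ) - s * k) / (s * m) *
      (Real.log k + Real.log (((n : ℝ) - s * k) / (n + s)) + Real.log (s / (8 * ε)))) ≤ μ := by
  have hkn : k ≤ n / s := (Nat.le_div_iff_mul_le hs).2 (by rw [mul_comm]; exact hskn.le)
  have key := p.block_error_bound μ hk hkn hm hε0 hbudget herror
  set N := n / s + 1 - k with hNdef
  have hNpos : (0 : ℝ) < N := by
    have : 0 < N := by omega
    exact_mod_cast this
  have hs' : (0 : ℝ) < s := by exact_mod_cast hs
  have hk' : (0 : ℝ) < k := by exact_mod_cast hk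
  have hd : (0 : ℝ) < (n : ℝ) - s * k := sub_pos.2 (by exact_mod_cast hskn)
  have hNk : (N : ℝ) + k = (n / s : ℕ) + 1 := by
    have : N + k = n / s + 1 := by omega
    exact_mod_cast this
  have hlow : (n : ℝ) < s * ((n / s : ℕ) + 1) := by
    have := Nat.lt_mul_div_succ n hs
    exact_mod_cast this
  have hupp : (s : ℝ) * (n / s : ℕ) ≤ n := by exact_mod_cast Nat.mul_div_le n s
  -- Rounding in `n / s` costs less than one block: the `+ 1` in `N` absorbs it here and produces
  -- the `n + s` in the next bound.
  have hNlow : (n : ℝ) - s * k ≤ s * N := by nlinarith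
  have hNupp : s * ((N : ℝ) + k) ≤ n + s := by nlinarith
  set X := Real.exp (μ ^ 2 / 2 * (m / N)) with hX
  have hXpos : 0 < X := Real.exp_pos _
  have hexp : Real.exp (-1 - μ ^ 2 / 2 * (m / N)) = (Real.exp 1 * X)⁻¹ := by
    rw [hX, ← Real.exp_add, ← Real.exp_neg]
    congr 1
    ring
  have hkey2 : k * (((n : ℝ) - s * k) / (n + s)) * (s / (8 * ε)) ≤ X := by
    rw [hexp] at key
    -- The argument yields the constant `exp 1`; the stated `8` is weaker.
    have he : Real.exp 1 ≤ 8 := by linarith [Real.exp_one_lt_d9]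
    have h1 : s * (k * (N : ℝ)) ≤ ε * (N + k) * (8 * X) := by
      have h2 : s * (Real.exp 1 * X)⁻¹ * (Real.exp 1 * X * (k * N)) ≤
          ε * (1 / N + 1 / k) * (Real.exp 1 * X * (k * N)) := by gcongr
      have h3 : s * (Real.exp 1 * X)⁻¹ * (Real.exp 1 * X * (k * N)) = s * (k * N) := by
        field_simp
      have h4 : ε * (1 / N + 1 / k) * (Real.exp 1 * X * (k * N)) =
          ε * (N + k) * (Real.exp 1 * X) := by
        field_simp
        ring
      rw [h3, h4] at h2
      exact h2.trans (by gcongr)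
    have hns : (0 : ℝ) < n + s := by positivity
    have h5 : k * (((n : ℝ) - s * k) / (n + s)) * (s / (8 * ε)) =
        s * k * ((n : ℝ) - s * k) / ((n + s) * (8 * ε)) := by
      field_simp
    rw [h5, div_le_iff₀ (by positivity)]
    calc s * k * ((n : ℝ) - s * k) ≤ s * k * (s * N) := by gcongr
      _ = s * (s * (k * N)) := by ring
      _ ≤ s * (ε * (N + k) * (8 * X)) := by gcongr
      _ = s * (N + k) * (8 * ε * X) := by ring
      _ ≤ (n + s) * (8 * ε * X) := by gcongr
      _ = X * ((n + s) * (8 * ε)) := by ring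
  have hlog : Real.log k + Real.log (((n : ℝ) - s * k) / (n + s)) + Real.log (s / (8 * ε)) ≤
      μ ^ 2 / 2 * (s * m / ((n : ℝ) - s * k)) := by
    rw [← Real.log_mul hk'.ne' (by positivity), ← Real.log_mul (by positivity) (by positivity)]
    refine (Real.log_le_log (by positivity) hkey2).trans ?_
    rw [hX, Real.log_exp]
    refine mul_le_mul_of_nonneg_left ?_ (by positivity)
    rw [div_le_div_iff₀ hNpos hd]
    nlinarith
  -- `Real.sqrt` is `0` on negative reals, so a negative radicand needs no separate case.
  refine Real.sqrt_le_iff.2 ⟨hμ.le, ?_⟩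
  calc _ ≤ 2 * ((n : ℝ) - s * k) / (s * m) * (μ ^ 2 / 2 * (s * m / ((n : ℝ) - s * k))) := by
        gcongr
    _ = μ ^ 2 := by field_simp
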